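/- **Setting.** A multipointed $d$-space $X=(|X|,X^0,\mathbb P^{top}X)$ consists of a $\Delta$-generated space $|X|$, a subset $X^0$ of states, and a set $\mathbb P^{top}X$ of continuous maps $[0,1]\to|X|$ (execution paths) with endpoints in $X^0$, closed under precomposition with non-decreasing surjective maps $[0,1]\to[0,1]$ and under normalized composition of composable paths (each path run through at double speed); maps are the continuous maps preserving states and execution paths. A *directed path* of $X$ is either a constant path $[0,1]\to |X|$, or a continuous map $\gamma:[0,1]\to|X|$ for which there are $\ell_1,\dots,\ell_n>0$ with $\sum_i\ell_i=1$, execution paths $\gamma_i$ and non-decreasing continuous maps $\phi_i:[0,1]\to[0,1]$ such that $\gamma(t)=\gamma_i(\phi_i((t-\sum_{j<i}\ell_j)/\ell_i))$ for $\sum_{j<i}\ell_j\le t\le\sum_{j\le i}\ell_j$. For a space $Z$, $\mathrm{Glob}^{top}(Z)$ has underlying space the quotient of $\{0,1\}\sqcup(Z\times[0,1])$ by $(z,0)=0$, $(z,1)=1$ for all $z\in Z$, set of states $\{0,1\}$, and execution paths $t\mapsto(z,\phi(t))$ with $z\in Z$ and $\phi:[0,1]\to[0,1]$ non-decreasing surjective.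 A *cellular multipointed $d$-space* $X_\lambda$ is the colimit of a transfinite tower $(X_\nu)$ of multipointed $d$-spaces, indexed by a non-empty well-ordered set and colimit-preserving at limit stages, such that $X_0=(X^0,X^0,\varnothing)$ with $X^0$ discrete and such that $X_{\nu+1}$ is, for every non-maximal $\nu$, a pushout of $X_\nu \xleftarrow{g_\nu}\mathrm{Glob}^{top}(\mathbf S^{n_\nu-1})\to\mathrm{Glob}^{top}(\mathbf D^{n_\nu})$ with $n_\nu\ge0$ and $\mathbf S^{-1}=\varnothing$. Let $\widehat{g_\nu}:\mathrm{Glob}^{top}(\mathbf D^{n_\nu})\to X_\lambda$ be the induced map. The *globular cells* of $X_\lambda$ are the states $\alpha\in X^0$ (dimension $0$, consisting of the single point $\alpha$, with closed cell $\widehat\alpha=\{\alpha\}$ and $\alpha^-=\alpha^+=\alpha$), and, for each non-maximal $\nu$, the cell $c_\nu$ of dimension $n_\nu+1$, identified with the image by $\widehat{g_\nu}$ of $|\mathrm{Glob}^{top}(\mathbf D^{n_\nu})|\setminus|\mathrm{Glob}^{top}(\mathbf S^{n_\nu-1})|$, with closed cell $\widehat{c_\nu}=\widehat{g_\nu}(|\mathrm{Glob}^{top}(\mathbf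 D^{n_\nu})|)$, $c_\nu^-=\widehat{g_\nu}(0)$ and $c_\nu^+=\widehat{g_\nu}(1)$. For $x\in|X_\lambda|$, $\mathrm{dt}(x)$ denotes the unique globular cell containing $x$. For two cells, $c\preceq d$ means that $c\ne d$ and ($c=d^-$ or $c^+=d$). A *discrete trace* is a finite sequence $[c_1,\dots,c_n]$, $n\ge1$, of globular cells with $c_1\preceq\dots\preceq c_n$. **Theorem 4.6.** Let $\gamma$ be a directed path of a cellular multipointed $d$-space $X_\lambda$. There is a unique discrete trace $[c_1,\dots,c_n]$ of $X_\lambda$ for which there exists a sequence of real numbers $0=t_0\le t_1\le\dots\le t_n=1$ such that * $t_{i-1}<t_i$ for every $1\le i\le n$ with $\dim c_i\ge1$; * $c_i\ne c_{i+1}$ for $1\le i<n$; * $\gamma(t)\in\widehat{c_i}$ for all $1\le i\le n$ and $t\in[t_{i-1},t_i]$; * $\mathrm{dt}(\gamma(t))=c_i$ for all $1\le i\le n$ and $t\in\,]t_{i-1},t_i[$; * $\mathrm{dt}(\gamma(t_i))\in\{c_i,c_{i+1}\}$ for $1\le i<n$; * $\mathrm{dt}(\gamma(0))=c_1$ and $\mathrm{dt}(\gamma(1))=c_n$.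 -/

import Mathlib

open CategoryTheory Topology

universe w u

noncomputable section

/-! ## Reparametrizations and normalized composition -/

/-- `φ ∈ 𝓜(1,1)`: a non-decreasing surjective continuous map from `[0,1]` to itself. -/
def IsReparam (φ : C(unitInterval, unitInterval)) : Prop :=
  Monotone φ ∧ Function.Surjective φ

/-- The normalized composition `γ₁ *_N γ₂` of two composable paths:
`t ↦ γ₁ (2t)` on `[0,1/2]` and `t ↦ γ₂ (2t-1)` on `[1/2,1]`. -/
def normComp {U : Type*} [TopologicalSpace U] (γ₁ γ₂ : C(unitInterval, U))
    (h : γ₁ 1 = γ₂ 0) : C(unitInterval, U) :=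
  ((Path.mk γ₁ rfl rfl : Path (γ₁ 0) (γ₁ 1)).trans
    (Path.mk γ₂ h.symm rfl : Path (γ₁ 1) (γ₂ 1))).toContinuousMap

/-! ## Multipointed `d`-spaces -/

/-- A multipointed `d`-space: a `Δ`-generated space with a distinguished set of states and a
set of execution paths. -/
structure MultipointedDSpace where
  carrier : Type u
  [top : TopologicalSpace carrier]
  [deltaGenerated : DeltaGeneratedSpace carrier]
  /-- the set of states -/
  states : Set carrier
  /-- the set of execution paths -/
  paths : Set C(unitInterval, carrier)
  source_mem : ∀ γ ∈ paths, γ 0 ∈ states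
  target_mem : ∀ γ ∈ paths, γ 1 ∈ states
  comp_reparam_mem : ∀ γ ∈ paths, ∀ φ : C(unitInterval, unitInterval), IsReparam φ →
    γ.comp φ ∈ paths
  normComp_mem : ∀ γ₁ ∈ paths, ∀ γ₂ ∈ paths, ∀ h : γ₁ 1 = γ₂ 0, normComp γ₁ γ₂ h ∈ paths

namespace MultipointedDSpace

instance : CoeSort MultipointedDSpace.{u} (Type u) := ⟨carrier⟩

attribute [instance] top deltaGenerated

/-- A map of multipointed `d`-spaces: a continuous map taking states to states and execution
paths to execution paths. -/
@[ext]
structure Hom (X Y : MultipointedDSpace.{u}) where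
  toMap : C(X, Y)
  map_states : ∀ x ∈ X.states, toMap x ∈ Y.states
  map_paths : ∀ γ ∈ X.paths, toMap.comp γ ∈ Y.paths

instance : Category MultipointedDSpace.{u} where
  Hom X Y := Hom X Y
  id X := ⟨ContinuousMap.id X, fun _ h => h, fun _ h => h⟩
  comp f g := ⟨g.toMap.comp f.toMap, fun x h => g.map_states _ (f.map_states x h),
    fun γ h => g.map_paths _ (f.map_paths γ h)⟩

/-- The multipointed `d`-space `(S, S, ∅)` associated with a set `S`, which is given the
discrete topology. -/
def ofSet (S : Type u) : MultipointedDSpace.{u} :=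
  letI : TopologicalSpace S := ⊥
  haveI : DiscreteTopology S := ⟨rfl⟩
  { carrier := S
    deltaGenerated := ⟨continuous_of_discreteTopology⟩
    states := Set.univ
    paths := ∅
    source_mem := fun _ _ => Set.mem_univ _
    target_mem := fun _ _ => Set.mem_univ _
    comp_reparam_mem := fun _ h => h.elim
    normComp_mem := fun _ h => h.elim }

/-- The set `d(X)` of directed paths of the directed space associated with `X`: the constant
paths and the Moore compositions `(γ₁φ₁μ_{ℓ₁}) * ⋯ * (γₙφₙμ_{ℓₙ})` with `ℓ₁ + ⋯ + ℓₙ = 1`,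
`γᵢ` an execution path, `φᵢ` a non-decreasing continuous map from `[0,1]` to itself and
`μ_ℓ (s) = s / ℓ`. The path with index `i` is run through on the segment from
`∑_{j<i} ℓ_j` to `∑_{j≤i} ℓ_j`. -/
def directedPaths (X : MultipointedDSpace.{u}) : Set C(unitInterval, X) :=
  {γ | (∃ x : X, γ = ContinuousMap.const unitInterval x) ∨
    ∃ (n : ℕ) (ℓ : Fin n → ℝ) (σ : Fin n → C(unitInterval, X))
      (φ : Fin n → C(unitInterval, unitInterval)),
      (∀ i, 0 < ℓ i) ∧ ∑ i, ℓ i = 1 ∧ (∀ i, σ i ∈ X.paths) ∧ (∀ i, Monotone (φ i)) ∧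
      ∀ (i : Fin n) (t : unitInterval),
        ∑ j ∈ Finset.Iio i, ℓ j ≤ (t : ℝ) → (t : ℝ) ≤ ∑ j ∈ Finset.Iic i, ℓ j →
        γ t = σ i (φ i (Set.projIcc (0 : ℝ) 1 zero_le_one
          (((t : ℝ) - ∑ j ∈ Finset.Iio i, ℓ j) / ℓ i)))}

end MultipointedDSpace

/-! ## Globes -/

namespace Globe

instance deltaGenerated_bool : DeltaGeneratedSpace Bool := ⟨continuous_of_discreteTopology⟩

/-- `[0,1]` is `Δ`-generated. -/
instance deltaGenerated_unitInterval : DeltaGeneratedSpace unitInterval := by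
  constructor
  have h : Continuous ((Topology.WithGeneratedByTopology.equiv
      (X := fun n : ℕ => Fin n → ℝ) (Y := unitInterval)).symm ∘
      fun v : Fin 1 → ℝ => Set.projIcc (0 : ℝ) 1 zero_le_one (v 0)) :=
    (Topology.IsGeneratedBy.equiv_symm_comp_continuous_iff (X := fun n : ℕ => Fin n → ℝ) _).2
      (continuous_projIcc.comp (continuous_apply 0))
  have h2 := h.comp
    (continuous_pi (fun _ => continuous_subtype_val) :
      Continuous (fun (t : unitInterval) (_ : Fin 1) => (t : ℝ)))
  convert h2 using 1
  funext t
  simp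

variable (Z : Type u) [TopologicalSpace Z]

/-- The product `Z × [0,1]` in the category of `Δ`-generated spaces. -/
abbrev Cylinder : Type u :=
  Topology.WithGeneratedByTopology (fun n : ℕ => Fin n → ℝ) (Z × unitInterval)

/-- The point `(z,t)` of the cylinder. -/
def cyl {Z : Type u} [TopologicalSpace Z] (z : Z) (t : unitInterval) : Cylinder Z :=
  Topology.WithGeneratedByTopology.equiv.symm (z, t)

/-- The identifications `(z,0) = 0` and `(z,1) = 1` (`false` stands for the state `0` and
`true` for the state `1`). -/
inductive Rel : Bool ⊕ Cylinder Z → Bool ⊕ Cylinder Z → Prop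
  | bot (z : Z) : Rel (Sum.inr (cyl z 0)) (Sum.inl false)
  | top (z : Z) : Rel (Sum.inr (cyl z 1)) (Sum.inl true)

/-- The underlying space of the topological globe of `Z`, with the quotient topology. -/
abbrev Space : Type u := Quot (Rel Z)

/-- The states `0` and `1` of the globe. -/
def vertex (b : Bool) : Space Z := Quot.mk _ (Sum.inl b)

variable {Z}

/-- The point `(z,t)` of the globe. -/
def pt (z : Z) (t : unitInterval) : Space Z := Quot.mk _ (Sum.inr (cyl z t))

lemma pt_zero (z : Z) : pt z 0 = vertex Z false := Quot.sound (Rel.bot z)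

lemma pt_one (z : Z) : pt z 1 = vertex Z true := Quot.sound (Rel.top z)

/-- The second projection of the globe onto `[0,1]`. -/
def height : Space Z → unitInterval :=
  Quot.lift (Sum.elim (fun b => bif b then 1 else 0)
    (fun p => (Topology.WithGeneratedByTopology.equiv p).2))
    (by rintro _ _ (z | z) <;> simp [cyl])

lemma vertex_ne : vertex Z true ≠ vertex Z false := fun h => by
  have : height (vertex Z true) = height (vertex Z false) := by rw [h]
  simp [height, vertex] at this

/-- The continuous map `δ_z : t ↦ (z,t)`. -/
def delta (z : Z) : C(unitInterval, Space Z) where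
  toFun t := pt z t
  continuous_toFun := continuous_quot_mk.comp (continuous_inr.comp
    ((Topology.IsGeneratedBy.equiv_symm_comp_continuous_iff
      (X := fun n : ℕ => Fin n → ℝ) (fun t : unitInterval => (z, t))).2 (by fun_prop)))

lemma delta_apply (z : Z) (t : unitInterval) : delta z t = pt z t := rfl

/-- The map of underlying spaces `(z,t) ↦ (f z,t)` induced by `f`. -/
def mapSpace {Z' : Type u} [TopologicalSpace Z'] (f : C(Z, Z')) : C(Space Z, Space Z') where
  toFun := Quot.lift (Sum.elim (vertex Z') (fun p =>
      pt (f (Topology.WithGeneratedByTopology.equiv p).1)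
        (Topology.WithGeneratedByTopology.equiv p).2))
    (by
      rintro _ _ (z | z)
      · exact pt_zero (f z)
      · exact pt_one (f z))
  continuous_toFun := by
    refine continuous_quot_lift _ (Continuous.sumElim continuous_of_discreteTopology ?_)
    refine continuous_quot_mk.comp (continuous_inr.comp
      ((Topology.IsGeneratedBy.equiv_symm_comp_continuous_iff (X := fun n : ℕ => Fin n → ℝ)
        (fun p : Cylinder Z => (f (Topology.WithGeneratedByTopology.equiv p).1,
          (Topology.WithGeneratedByTopology.equiv p).2))).2 ?_))
    have h : Continuous (Topology.WithGeneratedByTopology.equiv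
        (X := fun n : ℕ => Fin n → ℝ) (Y := Z × unitInterval)) :=
      Topology.WithGeneratedByTopology.continuous_equiv
    exact (f.continuous.comp (continuous_fst.comp h)).prodMk (continuous_snd.comp h)

lemma mapSpace_pt {Z' : Type u} [TopologicalSpace Z'] (f : C(Z, Z')) (z : Z)
    (t : unitInterval) : mapSpace f (pt z t) = pt (f z) t := rfl

lemma mapSpace_vertex {Z' : Type u} [TopologicalSpace Z'] (f : C(Z, Z')) (b : Bool) :
    mapSpace f (vertex Z b) = vertex Z' b := rfl

end Globe

lemma IsReparam.map_zero {φ : C(unitInterval, unitInterval)} (h : IsReparam φ) : φ 0 = 0 := by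
  obtain ⟨s, hs⟩ := h.2 0
  exact le_antisymm ((h.1 (unitInterval.nonneg' (t := s))).trans hs.le) unitInterval.nonneg'

lemma IsReparam.map_one {φ : C(unitInterval, unitInterval)} (h : IsReparam φ) : φ 1 = 1 := by
  obtain ⟨s, hs⟩ := h.2 1
  exact le_antisymm unitInterval.le_one' (hs.ge.trans (h.1 (unitInterval.le_one' (t := s))))

namespace MultipointedDSpace

/-- The topological globe of `Z`: its set of states is `{0,1}` and its execution paths are the
paths `δ_z φ` with `z ∈ Z` and `φ ∈ 𝓜(1,1)`. -/
def glob (Z : TopCat.{u}) : MultipointedDSpace.{u} where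
  carrier := Globe.Space Z
  states := Set.range (Globe.vertex Z)
  paths := {γ | ∃ (z : Z) (φ : C(unitInterval, unitInterval)),
    IsReparam φ ∧ γ = (Globe.delta z).comp φ}
  source_mem := by
    rintro _ ⟨z, φ, hφ, rfl⟩
    exact ⟨false, by simp [hφ.map_zero, Globe.delta_apply, Globe.pt_zero]⟩
  target_mem := by
    rintro _ ⟨z, φ, hφ, rfl⟩
    exact ⟨true, by simp [hφ.map_one, Globe.delta_apply, Globe.pt_one]⟩
  comp_reparam_mem := by
    rintro _ ⟨z, φ, hφ, rfl⟩ ψ hψ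
    exact ⟨z, φ.comp ψ, ⟨hφ.1.comp hψ.1, hφ.2.comp hψ.2⟩, rfl⟩
  normComp_mem := by
    rintro _ ⟨z, φ, hφ, rfl⟩ _ ⟨z', φ', hφ', rfl⟩ h
    simp only [ContinuousMap.comp_apply, hφ.map_one, hφ'.map_zero, Globe.delta_apply,
      Globe.pt_zero, Globe.pt_one] at h
    exact absurd h Globe.vertex_ne

/-- The map of globes induced by a continuous map. -/
def globMap {Z Z' : TopCat.{u}} (f : Z ⟶ Z') : glob Z ⟶ glob Z' :=
  Hom.mk (X := glob Z) (Y := glob Z') (Globe.mapSpace f.hom)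
    (by rintro _ ⟨b, rfl⟩; exact ⟨b, rfl⟩)
    (by rintro _ ⟨z, φ, hφ, rfl⟩; exact ⟨f.hom z, φ, hφ, rfl⟩)

end MultipointedDSpace

/-! ## Cellular multipointed `d`-spaces -/

open MultipointedDSpace

/-- A cellular multipointed `d`-space indexed by a well-ordered set `J` with a least element.
`K.tower` contains a functor `X : J ⥤ MultipointedDSpace` which is colimit-preserving at limit
elements of `J`, an isomorphism between its value at the least element and `(S, S, ∅)`, and a
colimit cocone of this functor with point `K.X`. For `ν` in `J` which is not the
greatest element, `X_{ν+1}` is obtained from `X_ν` by attaching a globe of the disk of dimension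
`K.n ν` along the globe of its boundary sphere. A tower `(X_ν)_{ν<κ}` with `κ` a limit
ordinal is the case `J = κ`; a tower with a last term `X_κ` is the case `J = κ + 1`. -/
structure CellularMultipointedDSpace (J : Type w) [LinearOrder J] [OrderBot J] [SuccOrder J]
    [WellFoundedLT J] where
  /-- the set of states one starts from -/
  S : Type u
  /-- the transfinite composition `X_λ` -/
  X : MultipointedDSpace.{u}
  /-- the canonical map from the first term of the tower -/
  base : ofSet S ⟶ X
  tower : TransfiniteCompositionOfShape J base
  /-- the dimension of the disk attached at each stage -/
  n : ∀ ν : J, ¬ IsMax ν → ℕ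
  g : ∀ (ν : J) (hν : ¬ IsMax ν), glob (TopCat.diskBoundary.{u} (n ν hν)) ⟶ tower.F.obj ν
  gHat : ∀ (ν : J) (hν : ¬ IsMax ν),
    glob (TopCat.disk.{u} (n ν hν)) ⟶ tower.F.obj (Order.succ ν)
  isPushout : ∀ (ν : J) (hν : ¬ IsMax ν),
    IsPushout (g ν hν) (globMap (TopCat.diskBoundaryInclusion (n ν hν)))
      (tower.F.map (homOfLE (Order.le_succ ν))) (gHat ν hν)

namespace CellularMultipointedDSpace

variable {J : Type w} [LinearOrder J] [OrderBot J] [SuccOrder J] [WellFoundedLT J]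
  (K : CellularMultipointedDSpace.{w, u} J)

/-- The attaching map of the `ν`-th globular cell, with values in `X_λ`. -/
def attach (ν : J) (hν : ¬ IsMax ν) : glob (TopCat.disk.{u} (K.n ν hν)) ⟶ K.X :=
  K.gHat ν hν ≫ K.tower.incl.app (Order.succ ν)

/-- The globular cells of `X_λ`: the states (the cells of dimension `0`) and one cell for each
attached globe. -/
inductive Cell
  | state (a : K.X.states)
  | globe (ν : J) (hν : ¬ IsMax ν)

namespace Cell

variable {K}

/-- The dimension of a globular cell. -/
def dim : K.Cell → ℕ
  | state _ => 0
  | globe ν hν => K.n ν hν + 1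

/-- The initial state `c⁻` of a globular cell. -/
def initial : K.Cell → K.X.states
  | state a => a
  | globe ν hν => ⟨(K.attach ν hν).toMap (Globe.vertex _ false),
      (K.attach ν hν).map_states _ ⟨false, rfl⟩⟩

/-- The final state `c⁺` of a globular cell. -/
def final : K.Cell → K.X.states
  | state a => a
  | globe ν hν => ⟨(K.attach ν hν).toMap (Globe.vertex _ true),
      (K.attach ν hν).map_states _ ⟨true, rfl⟩⟩

/-- The points of `X_λ` lying in the (open) globular cell: the image under the attaching map of
the complement of the globe of the sphere in the globe of the disk. -/
def points : K.Cell → Set K.X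
  | state a => {(a : K.X)}
  | globe ν hν => (K.attach ν hν).toMap ''
      (Set.range (globMap (TopCat.diskBoundaryInclusion.{u} (K.n ν hν))).toMap)ᶜ

/-- The closed globular cell: the image of the whole globe of the disk. -/
def closedPoints : K.Cell → Set K.X
  | state a => {(a : K.X)}
  | globe ν hν => Set.range (K.attach ν hν).toMap

/-- The relation `c ⪯ d` between globular cells. -/
def Prec (c d : K.Cell) : Prop :=
  c ≠ d ∧ (c = state d.initial ∨ state c.final = d)

end Cell

/-- `c` is the unique globular cell containing the point `x`. -/
def IsCellOf (x : K.X) (c : K.Cell) : Prop :=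
  x ∈ c.points ∧ ∀ d : K.Cell, x ∈ d.points → d = c

/-- A discrete trace: a finite sequence `[c₁, …, cₙ]` of globular cells with
`c₁ ⪯ ⋯ ⪯ cₙ`, `n ≥ 1`. -/
def IsDiscreteTrace (L : List K.Cell) : Prop :=
  L ≠ [] ∧ L.IsChain Cell.Prec

/-- The sequence `0 = t₀ ≤ ⋯ ≤ tₙ = 1` exhibits `L = [c₁, …, cₙ]` as the list of the globular
cells successively visited by `γ`. The cell `cᵢ` is `L[i-1]` and its segment is
`[t_{i-1}, t_i]`, which has to be non-degenerate when `cᵢ` is not a state. -/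
structure Subdivides (γ : C(unitInterval, K.X)) (L : List K.Cell)
    (t : Fin (L.length + 1) → unitInterval) : Prop where
  first : t 0 = 0
  last : t (Fin.last L.length) = 1
  mono : Monotone t
  nondegenerate : ∀ i : Fin L.length, 1 ≤ (L.get i).dim → t i.castSucc < t i.succ
  ne_next : ∀ (i : ℕ) (h : i + 1 < L.length), L[i] ≠ L[i + 1]
  closed_mem : ∀ (i : Fin L.length) (s : unitInterval), t i.castSucc ≤ s → s ≤ t i.succ →
    γ s ∈ (L.get i).closedPoints
  open_mem : ∀ (i : Fin L.length) (s : unitInterval), t i.castSucc < s → s < t i.succ →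
    K.IsCellOf (γ s) (L.get i)
  break_mem : ∀ (i : ℕ) (h : i + 1 < L.length),
    K.IsCellOf (γ (t ⟨i + 1, by omega⟩)) L[i] ∨ K.IsCellOf (γ (t ⟨i + 1, by omega⟩)) L[i + 1]
  source_mem : ∀ c ∈ L.head?, K.IsCellOf (γ 0) c
  target_mem : ∀ c ∈ L.getLast?, K.IsCellOf (γ 1) c

end CellularMultipointedDSpace

end

/-!
Write `X` for the cellular multipointed `d`-space. The trace of a directed path exists because an
execution path of `X` is a finite composite of reparametrized paths `t ↦ (z,t)` of single globes,
and it is unique because the states in a discrete trace separate the other cells.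

*The cells.* The underlying set functor is left adjoint to `chaotic`, hence preserves colimits. So
the underlying set of `X` is built by pushouts of sets along injections and transfinite
compositions. Consequently each point lies in exactly one cell (`exists_mem_points`,
`cell_eq_of_mem_points`): the points of `c_ν` appear at stage `ν + 1` and at no earlier one.

*The execution paths.* A class of points and paths stable under reparametrization and normalized
composition defines a multipointed `d`-space mapping to `X`. If the legs of a colimit cocone factor
through it, the universal property shows that the class contains all states and execution paths.
Along the tower this gives the induction principle `contains_id`: it is enough to consider the
paths `t ↦ (z,t)` with `z` not in the boundary sphere, since those over the boundary sphere come
from the previous stage.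

*Existence.* A path `t ↦ (z, ψ t)` with `ψ` monotone rests at the initial state, crosses the open
cell and rests at the final state, some of these parts being possibly absent
(`hasTrace_attach_pt`). Traces on adjacent segments can be glued, because both have the cell of the
common endpoint at the junction (`HasTrace.trans`). Hence the paths which have a trace after every
monotone reparametrization, surjective or not, form a class as above
(`monotoneTraceable_of_mem_paths`), and directed paths follow by gluing.

*Uniqueness.* In a discrete trace, states alternate with cells of positive dimension. The latter
are visited on non-degenerate segments, the path being at a state at each break. So the first cell
determines the first break, then the next cell, and so on (`Traces.unique`).
-/

noncomputable section

open MultipointedDSpace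

/-! ### Globes as sets -/

namespace Globe

variable {Z : Type u} [TopologicalSpace Z]

open Classical in
/-- The first coordinate of a point of the globe: `some z` at `(z,t)` with `0 < t < 1`, and
`none` at the two vertices, where `z` is not determined. -/
def label : Space Z → Option Z :=
  Quot.lift (Sum.elim (fun _ => none)
    (fun p => if (Topology.WithGeneratedByTopology.equiv p).2 = 0 ∨
        (Topology.WithGeneratedByTopology.equiv p).2 = 1 then none
      else some (Topology.WithGeneratedByTopology.equiv p).1))
    (by rintro _ _ (z | z) <;> simp [cyl])

lemma label_vertex (b : Bool) : label (vertex Z b) = none := rfl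

lemma label_pt (z : Z) {t : unitInterval} (h0 : t ≠ 0) (h1 : t ≠ 1) :
    label (pt z t) = some z := by
  simp [label, pt, cyl, h0, h1]

lemma height_vertex (b : Bool) : height (vertex Z b) = bif b then 1 else 0 := rfl

lemma height_pt (z : Z) (t : unitInterval) : height (pt z t) = t := rfl

lemma eq_vertex_or_eq_pt (q : Space Z) :
    (∃ b, q = vertex Z b) ∨ ∃ (z : Z) (t : unitInterval), t ≠ 0 ∧ t ≠ 1 ∧ q = pt z t := by
  induction q using Quot.ind with
  | mk a =>
    obtain b | p := a
    · exact Or.inl ⟨b, rfl⟩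
    · obtain ⟨⟨z, t⟩, rfl⟩ := Topology.WithGeneratedByTopology.equiv.symm.surjective p
      change (∃ b, pt z t = vertex Z b) ∨ ∃ (z' : Z) (t' : unitInterval),
        t' ≠ 0 ∧ t' ≠ 1 ∧ pt z t = pt z' t'
      by_cases h0 : t = 0
      · exact Or.inl ⟨false, by rw [h0, pt_zero]⟩
      by_cases h1 : t = 1
      · exact Or.inl ⟨true, by rw [h1, pt_one]⟩
      exact Or.inr ⟨z, t, h0, h1, rfl⟩

/-- A point of the globe is determined by its height and its label. -/
lemma ext_of_height_label {p q : Space Z} (hh : height p = height q)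
    (hl : label p = label q) : p = q := by
  obtain ⟨b, rfl⟩ | ⟨z, t, h0, h1, rfl⟩ := eq_vertex_or_eq_pt p <;>
  obtain ⟨b', rfl⟩ | ⟨z', t', h0', h1', rfl⟩ := eq_vertex_or_eq_pt q
  · cases b <;> cases b' <;> simp_all [height_vertex]
  · simp [label_vertex, label_pt z' h0' h1'] at hl
  · simp [label_vertex, label_pt z h0 h1] at hl
  · rw [label_pt z h0 h1, label_pt z' h0' h1'] at hl
    rw [height_pt, height_pt] at hh
    rw [Option.some.inj hl, hh]

variable {Z' : Type u} [TopologicalSpace Z']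

lemma height_mapSpace (f : C(Z, Z')) (q : Space Z) : height (mapSpace f q) = height q := by
  obtain ⟨b, rfl⟩ | ⟨z, t, h0, h1, rfl⟩ := eq_vertex_or_eq_pt q <;> rfl

lemma label_mapSpace (f : C(Z, Z')) (q : Space Z) :
    label (mapSpace f q) = (label q).map f := by
  obtain ⟨b, rfl⟩ | ⟨z, t, h0, h1, rfl⟩ := eq_vertex_or_eq_pt q
  · rfl
  · rw [mapSpace_pt, label_pt _ h0 h1, label_pt _ h0 h1, Option.map_some]

lemma mapSpace_injective {f : C(Z, Z')} (hf : Function.Injective f) :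
    Function.Injective (mapSpace f) := fun p q h =>
  ext_of_height_label (by rw [← height_mapSpace f, h, height_mapSpace])
    (Option.map_injective hf (by rw [← label_mapSpace, h, label_mapSpace]))

lemma pt_notMem_range_mapSpace (f : C(Z, Z')) {z : Z'} (hz : z ∉ Set.range f)
    {t : unitInterval} (h0 : t ≠ 0) (h1 : t ≠ 1) : pt z t ∉ Set.range (mapSpace f) := by
  rintro ⟨q, hq⟩
  have h := label_mapSpace f q
  rw [hq, label_pt z h0 h1] at h
  obtain ⟨a, -, ha⟩ := Option.map_eq_some_iff.1 h.symm
  exact hz ⟨a, ha⟩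

end Globe

/-! ### Colimits of multipointed `d`-spaces -/

namespace MultipointedDSpace

/-- The underlying set functor. -/
def carrierFunctor : MultipointedDSpace.{u} ⥤ Type u where
  obj X := X.carrier
  map f := ↾ f.toMap

/-- The set `Y` with the `Δ`-generated topology associated with the indiscrete one, all points
being states and all paths being execution paths. -/
def chaotic (Y : Type u) : MultipointedDSpace.{u} :=
  letI : TopologicalSpace Y := ⊤
  { carrier := Topology.WithGeneratedByTopology (fun n : ℕ => Fin n → ℝ) Y
    states := Set.univ
    paths := Set.univ
    source_mem := fun _ _ => Set.mem_univ _
    target_mem := fun _ _ => Set.mem_univ _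
    comp_reparam_mem := fun _ _ _ _ => Set.mem_univ _
    normComp_mem := fun _ _ _ _ _ => Set.mem_univ _ }

lemma continuous_chaotic {X : MultipointedDSpace.{u}} {Y : Type u} (f : X → chaotic Y) :
    Continuous f := by
  let _ : TopologicalSpace Y := ⊤
  let f' : X → Y := f
  exact (Topology.IsGeneratedBy.equiv_symm_comp_continuous_iff
    (X := fun n : ℕ => Fin n → ℝ) f').2 continuous_top

/-- Every map of sets into `Y` is a map of multipointed `d`-spaces into `chaotic Y`. -/
def toChaotic {X : MultipointedDSpace.{u}} {Y : Type u} (f : X → Y) : X ⟶ chaotic Y :=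
  Hom.mk (X := X) (Y := chaotic Y) ⟨f, continuous_chaotic (Y := Y) f⟩
    (fun _ _ => Set.mem_univ _) (fun _ _ => Set.mem_univ _)

/-- The underlying set functor preserves colimits, being left adjoint to `chaotic`. -/
instance : carrierFunctor.{u}.IsLeftAdjoint := by
  refine (Adjunction.adjunctionOfEquivRight (F := carrierFunctor.{u}) (G_obj := chaotic)
    (fun X Y => ?_) ?_).isLeftAdjoint
  · exact
      { toFun f := toChaotic f
        invFun f := ↾ f.toMap
        left_inv _ := rfl
        right_inv _ := rfl }
  · intros; rfl

end MultipointedDSpace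

/-! ### Classes of execution paths -/

lemma normComp_apply {U : Type*} [TopologicalSpace U] (γ₁ γ₂ : C(unitInterval, U))
    (h : γ₁ 1 = γ₂ 0) (t : unitInterval) : normComp γ₁ γ₂ h t =
      if (t : ℝ) ≤ 1 / 2 then γ₁ (Set.projIcc (0 : ℝ) 1 zero_le_one (2 * t))
      else γ₂ (Set.projIcc (0 : ℝ) 1 zero_le_one (2 * t - 1)) := by
  have ht := t.2
  refine (Path.trans_apply _ _ t).trans ?_
  split_ifs with h1
  · rw [Set.projIcc_of_mem zero_le_one (x := 2 * (t : ℝ)) ⟨by linarith [ht.1], by linarith⟩]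
    rfl
  · rw [Set.projIcc_of_mem zero_le_one (x := 2 * (t : ℝ) - 1) ⟨by linarith, by linarith [ht.2]⟩]
    rfl

namespace MultipointedDSpace

/-- A class of points and paths of a multipointed `d`-space, the class of paths being stable
under reparametrization and normalized composition. -/
structure PathClass (X : MultipointedDSpace.{u}) where
  points : Set X
  paths : Set C(unitInterval, X)
  comp_mem : ∀ γ ∈ paths, ∀ φ : C(unitInterval, unitInterval), IsReparam φ → γ.comp φ ∈ paths
  normComp_mem : ∀ γ₁ ∈ paths, ∀ γ₂ ∈ paths, ∀ h : γ₁ 1 = γ₂ 0, normComp γ₁ γ₂ h ∈ paths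

namespace PathClass

variable {X Y : MultipointedDSpace.{u}}

/-- The states and the execution paths of `X` which belong to the class `P`. -/
def toDSpace (P : PathClass X) : MultipointedDSpace.{u} where
  carrier := X
  states := X.states ∩ P.points
  paths := {γ | γ ∈ X.paths ∧ γ ∈ P.paths ∧ γ 0 ∈ P.points ∧ γ 1 ∈ P.points}
  source_mem γ h := ⟨X.source_mem γ h.1, h.2.2.1⟩
  target_mem γ h := ⟨X.target_mem γ h.1, h.2.2.2⟩
  comp_reparam_mem γ h φ hφ := ⟨X.comp_reparam_mem γ h.1 φ hφ, P.comp_mem γ h.2.1 φ hφ, by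
    rw [ContinuousMap.comp_apply, hφ.map_zero]; exact h.2.2.1, by
    rw [ContinuousMap.comp_apply, hφ.map_one]; exact h.2.2.2⟩
  normComp_mem γ₁ h₁ γ₂ h₂ h := ⟨X.normComp_mem γ₁ h₁.1 γ₂ h₂.1 h,
    P.normComp_mem γ₁ h₁.2.1 γ₂ h₂.2.1 h, by
      have : normComp γ₁ γ₂ h 0 = γ₁ 0 := Path.source _
      rw [this]; exact h₁.2.2.1, by
      have : normComp γ₁ γ₂ h 1 = γ₂ 1 := Path.target _
      rw [this]; exact h₂.2.2.2⟩

/-- The canonical map `P.toDSpace ⟶ X`, which is the identity on underlying spaces. -/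
def ι (P : PathClass X) : P.toDSpace ⟶ X :=
  Hom.mk (X := P.toDSpace) (Y := X) (ContinuousMap.id X) (fun _ h => h.1) (fun _ h => h.1)

instance (P : PathClass X) : Mono P.ι :=
  ⟨fun f g h => Hom.ext (show f.toMap = g.toMap from
    congrArg (fun k : _ ⟶ X => k.toMap) h)⟩

/-- The map `f` takes states and execution paths into the class `P`. -/
def Contains (P : PathClass X) (f : Y ⟶ X) : Prop :=
  (∀ y ∈ Y.states, f.toMap y ∈ P.points) ∧ ∀ γ ∈ Y.paths, f.toMap.comp γ ∈ P.paths

/-- A map contained in the class `P` factors through `P.toDSpace`. -/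
def lift (P : PathClass X) (f : Y ⟶ X) (hf : P.Contains f) : Y ⟶ P.toDSpace :=
  Hom.mk (X := Y) (Y := P.toDSpace) f.toMap (fun y h => ⟨f.map_states y h, hf.1 y h⟩)
    (fun γ h => ⟨f.map_paths γ h, hf.2 γ h, hf.1 _ (Y.source_mem γ h),
      hf.1 _ (Y.target_mem γ h)⟩)

@[simp]
lemma lift_ι (P : PathClass X) (f : Y ⟶ X) (hf : P.Contains f) : P.lift f hf ≫ P.ι = f := rfl

lemma contains_ι (P : PathClass X) : P.Contains P.ι :=
  ⟨fun _ h => h.2, fun _ h => h.2.1⟩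

lemma Contains.comp {Z : MultipointedDSpace.{u}} {P : PathClass X} {f : Y ⟶ X}
    (hf : P.Contains f) (g : Z ⟶ Y) : P.Contains (g ≫ f) :=
  ⟨fun z hz => hf.1 _ (g.map_states z hz), fun γ hγ => hf.2 _ (g.map_paths γ hγ)⟩

/-- The inverse image of a class under a map. -/
def comap (P : PathClass X) (f : Y ⟶ X) : PathClass Y where
  points := f.toMap ⁻¹' P.points
  paths := {γ | f.toMap.comp γ ∈ P.paths}
  comp_mem γ h φ hφ := P.comp_mem _ h φ hφ
  normComp_mem γ₁ h₁ γ₂ h₂ h := by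
    have h' : (f.toMap.comp γ₁) 1 = (f.toMap.comp γ₂) 0 := congrArg f.toMap h
    have : f.toMap.comp (normComp γ₁ γ₂ h) =
        normComp (f.toMap.comp γ₁) (f.toMap.comp γ₂) h' := by
      ext t
      rw [ContinuousMap.comp_apply, normComp_apply, normComp_apply]
      split_ifs <;> rfl
    change f.toMap.comp (normComp γ₁ γ₂ h) ∈ P.paths
    rw [this]
    exact P.normComp_mem _ h₁ _ h₂ h'

lemma contains_comap_iff {Z : MultipointedDSpace.{u}} (P : PathClass X) (f : Y ⟶ X)
    (g : Z ⟶ Y) : (P.comap f).Contains g ↔ P.Contains (g ≫ f) := Iff.rfl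

/-- A class containing the legs of a colimit cocone contains the states and the execution paths
of the colimit. -/
lemma contains_id_of_isColimit {C : Type*} [Category* C] {F : C ⥤ MultipointedDSpace.{u}}
    {c : Limits.Cocone F} (hc : Limits.IsColimit c) (P : PathClass c.pt)
    (h : ∀ j, P.Contains (c.ι.app j)) : P.Contains (𝟙 c.pt) := by
  let s : Limits.Cocone F :=
    { pt := P.toDSpace
      ι :=
        { app j := P.lift (c.ι.app j) (h j)
          naturality i j f := (cancel_mono P.ι).1 (c.ι.naturality f) } }
  have : hc.desc s ≫ P.ι = 𝟙 c.pt := hc.hom_ext fun j => by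
    rw [hc.fac_assoc, Category.comp_id]; rfl
  rw [← this]
  exact P.contains_ι.comp _

/-- A class containing the two maps into a pushout contains its states and its execution
paths. -/
lemma contains_id_of_isPushout {A B Y' : MultipointedDSpace.{u}} {f : A ⟶ B} {g : A ⟶ Y'}
    {inl : B ⟶ X} {inr : Y' ⟶ X} (hp : IsPushout f g inl inr) (P : PathClass X)
    (hl : P.Contains inl) (hr : P.Contains inr) : P.Contains (𝟙 X) := by
  have hw : f ≫ P.lift inl hl = g ≫ P.lift inr hr := (cancel_mono P.ι).1 hp.w
  have : hp.desc _ _ hw ≫ P.ι = 𝟙 X := hp.hom_ext (by simp) (by simp)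
  rw [← this]
  exact P.contains_ι.comp _

end PathClass

end MultipointedDSpace

instance {J : Type w} [LinearOrder J] :
    Limits.PreservesWellOrderContinuousOfShape J carrierFunctor.{u} where

/-! ### The globular cells of a cellular multipointed `d`-space -/

namespace CellularMultipointedDSpace

variable {J : Type w} [LinearOrder J] [OrderBot J] [SuccOrder J] [WellFoundedLT J]
  (K : CellularMultipointedDSpace.{w, u} J)

/-- The canonical map from the `ν`-th term of the tower to `X_λ`. -/
def inc (ν : J) : K.tower.F.obj ν ⟶ K.X := K.tower.incl.app ν

lemma map_inc {μ ν : J} (h : μ ≤ ν) : K.tower.F.map (homOfLE h) ≫ K.inc ν = K.inc μ :=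
  (K.tower.incl.naturality (homOfLE h)).trans (Category.comp_id _)

lemma inc_map_apply {μ ν : J} (h : μ ≤ ν) (x : K.tower.F.obj μ) :
    (K.inc ν).toMap ((K.tower.F.map (homOfLE h)).toMap x) = (K.inc μ).toMap x :=
  congrArg (fun f : K.tower.F.obj μ ⟶ K.X => f.toMap x) (K.map_inc h)

lemma attach_eq (ν : J) (hν : ¬ IsMax ν) :
    K.attach ν hν = K.gHat ν hν ≫ K.inc (Order.succ ν) := rfl

lemma attach_globMap (ν : J) (hν : ¬ IsMax ν) :
    globMap (TopCat.diskBoundaryInclusion.{u} (K.n ν hν)) ≫ K.attach ν hν =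
      K.g ν hν ≫ K.inc ν := by
  rw [attach_eq, ← Category.assoc, ← (K.isPushout ν hν).w, Category.assoc, map_inc]

lemma globMap_injective (n : ℕ) :
    Function.Injective (globMap (TopCat.diskBoundaryInclusion.{u} n)).toMap :=
  Globe.mapSpace_injective ((TopCat.mono_iff_injective _).1 inferInstance)

/-- The underlying sets of an attaching square form a pushout square. -/
lemma isPushout_carrier (ν : J) (hν : ¬ IsMax ν) :
    IsPushout (carrierFunctor.map (globMap (TopCat.diskBoundaryInclusion.{u} (K.n ν hν))))
      (carrierFunctor.map (K.g ν hν)) (carrierFunctor.map (K.gHat ν hν))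
      (carrierFunctor.map (K.tower.F.map (homOfLE (Order.le_succ ν)))) :=
  ((K.isPushout ν hν).map carrierFunctor).flip

lemma exists_of_succ (ν : J) (hν : ¬ IsMax ν) (x : K.tower.F.obj (Order.succ ν)) :
    (∃ y, (K.tower.F.map (homOfLE (Order.le_succ ν))).toMap y = x) ∨
      ∃ q, (K.gHat ν hν).toMap q = x ∧
        q ∉ Set.range (globMap (TopCat.diskBoundaryInclusion.{u} (K.n ν hν))).toMap :=
  Limits.Types.eq_or_eq_of_isPushout' (K.isPushout_carrier ν hν).flip x

/-- The points of an open cell are not in the term of the tower to which it is attached. -/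
lemma gHat_notMem_range (ν : J) (hν : ¬ IsMax ν) {q : glob (TopCat.disk.{u} (K.n ν hν))}
    (hq : q ∉ Set.range (globMap (TopCat.diskBoundaryInclusion.{u} (K.n ν hν))).toMap)
    (y : K.tower.F.obj ν) :
    (K.gHat ν hν).toMap q ≠ (K.tower.F.map (homOfLE (Order.le_succ ν))).toMap y := fun h => by
  have hp := Limits.Types.isPullback_of_isPushout (K.isPushout_carrier ν hν)
    (globMap_injective _)
  obtain ⟨s, hs, -⟩ := ((Limits.Types.isPullback_iff _ _ _ _).1 hp).2.2 q y h
  exact hq ⟨s, hs⟩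

lemma inc_injective (ν : J) : Function.Injective (K.inc ν).toMap := by
  let T : (MorphismProperty.monomorphisms (Type u)).TransfiniteCompositionOfShape J
      (carrierFunctor.map K.base) :=
    { K.tower.map carrierFunctor with
      map_mem ν hν := (mono_iff_injective _).2
        (Limits.Types.pushoutCocone_inr_injective_of_isColimit
          (K.isPushout_carrier ν hν).isColimit (globMap_injective _)) }
  have h : Mono (T.incl.app ν) := T.mem_incl_app ν
  exact (mono_iff_injective _).1 h

lemma exists_inc (x : K.X) : ∃ (ν : J) (y : K.tower.F.obj ν), (K.inc ν).toMap y = x :=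
  Limits.Types.jointly_surjective_of_isColimit (K.tower.map carrierFunctor).isColimit x

lemma exists_of_isSuccLimit {ν : J} (hν : Order.IsSuccLimit ν) (x : K.tower.F.obj ν) :
    ∃ (μ : J) (h : μ < ν) (y : K.tower.F.obj μ),
      (K.tower.F.map (homOfLE h.le)).toMap y = x := by
  obtain ⟨μ, y, hy⟩ := Limits.Types.jointly_surjective_of_isColimit
    (Limits.isColimitOfPreserves carrierFunctor
      (K.tower.F.isColimitOfIsWellOrderContinuous ν hν)) x
  exact ⟨μ, μ.2, y, hy⟩

lemma exists_isoBot (x : K.tower.F.obj ⊥) : ∃ s : K.S, (K.inc ⊥).toMap x = K.base.toMap s := by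
  refine ⟨K.tower.isoBot.hom.toMap x, ?_⟩
  have h : K.inc ⊥ = K.tower.isoBot.hom ≫ K.base := by
    exact (Iso.inv_comp_eq _).1 K.tower.fac
  rw [h]; rfl

lemma base_eq (s : K.S) : K.base.toMap s = (K.inc ⊥).toMap (K.tower.isoBot.inv.toMap s) :=
  congrArg (fun f : ofSet K.S ⟶ K.X => f.toMap s) K.tower.fac.symm

/-- Induction principle for the states and the execution paths of `X_λ`: a class which contains
the initial states and, for each cell, the paths `t ↦ (z,t)` where `z` is not on the boundary of
the disk, contains all states and all execution paths. -/
lemma contains_id (P : PathClass K.X) (hS : ∀ s : K.S, K.base.toMap s ∈ P.points)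
    (hP : ∀ (ν : J) (hν : ¬ IsMax ν) (z : TopCat.disk.{u} (K.n ν hν)),
      z ∉ Set.range (TopCat.diskBoundaryInclusion.{u} (K.n ν hν)) →
      (K.attach ν hν).toMap.comp (Globe.delta z) ∈ P.paths) : P.Contains (𝟙 K.X) := by
  refine P.contains_id_of_isColimit K.tower.isColimit fun ν => ?_
  change P.Contains (K.inc ν)
  induction ν using SuccOrder.limitRecOn with
  | isMin ν hν =>
    obtain rfl := hν.eq_bot
    refine ⟨fun y _ => ?_, fun γ hγ => (K.tower.isoBot.hom.map_paths γ hγ).elim⟩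
    obtain ⟨s, hs⟩ := K.exists_isoBot y
    exact hs ▸ hS s
  | succ ν hν ih =>
    rw [← Category.id_comp (K.inc _), ← PathClass.contains_comap_iff]
    have hl : (P.comap (K.inc (Order.succ ν))).Contains
        (K.tower.F.map (homOfLE (Order.le_succ ν))) := by
      rw [PathClass.contains_comap_iff, map_inc]
      exact ih
    refine PathClass.contains_id_of_isPushout (K.isPushout ν hν) _ hl ?_
    change P.Contains (K.attach ν hν)
    have hg : P.Contains
        (globMap (TopCat.diskBoundaryInclusion.{u} (K.n ν hν)) ≫ K.attach ν hν) := by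
      rw [attach_globMap]
      exact ih.comp _
    constructor
    · rintro _ ⟨b, rfl⟩
      exact hg.1 _ ⟨b, rfl⟩
    · rintro _ ⟨z, φ, hφ, rfl⟩
      by_cases hz : z ∈ Set.range (TopCat.diskBoundaryInclusion.{u} (K.n ν hν))
      · obtain ⟨z, rfl⟩ := hz
        exact hg.2 _ ⟨z, φ, hφ, rfl⟩
      · exact P.comp_mem _ (hP ν hν z hz) φ hφ
  | isSuccLimit ν hν ih =>
    rw [← Category.id_comp (K.inc _), ← PathClass.contains_comap_iff]
    refine PathClass.contains_id_of_isColimit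
      (K.tower.F.isColimitOfIsWellOrderContinuous ν hν) (P.comap (K.inc ν)) fun μ => ?_
    have h : P.Contains (K.tower.F.map (homOfLE μ.2.le) ≫ K.inc ν) := by
      rw [map_inc]
      exact ih μ.1 μ.2
    exact h

lemma exists_base_of_mem_states {x : K.X} (hx : x ∈ K.X.states) :
    ∃ s : K.S, K.base.toMap s = x := by
  let P : PathClass K.X :=
    { points := Set.range K.base.toMap
      paths := Set.univ
      comp_mem := fun _ _ _ _ => Set.mem_univ _
      normComp_mem := fun _ _ _ _ _ => Set.mem_univ _ }
  exact (K.contains_id P (fun s => ⟨s, rfl⟩) (fun _ _ _ _ => Set.mem_univ _)).1 x hx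

lemma base_mem_states (s : K.S) : K.base.toMap s ∈ K.X.states :=
  K.base.map_states s (Set.mem_univ _)

lemma exists_mem_points_inc (ν : J) (x : K.tower.F.obj ν) :
    ∃ c : K.Cell, (K.inc ν).toMap x ∈ c.points := by
  induction ν using SuccOrder.limitRecOn with
  | isMin ν hν =>
    obtain rfl := hν.eq_bot
    obtain ⟨s, hs⟩ := K.exists_isoBot x
    exact ⟨.state ⟨_, K.base_mem_states s⟩, hs⟩
  | succ ν hν ih =>
    obtain ⟨y, rfl⟩ | ⟨q, rfl, hq⟩ := K.exists_of_succ ν hν x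
    · rw [inc_map_apply]
      exact ih y
    · exact ⟨.globe ν hν, q, hq, rfl⟩
  | isSuccLimit ν hν ih =>
    obtain ⟨μ, h, y, rfl⟩ := K.exists_of_isSuccLimit hν x
    rw [inc_map_apply]
    exact ih μ h y

lemma exists_mem_points (x : K.X) : ∃ c : K.Cell, x ∈ c.points := by
  obtain ⟨ν, y, rfl⟩ := K.exists_inc x
  exact K.exists_mem_points_inc ν y

/-- The points of the cell `c_ν` do not come from the `ν`-th term of the tower. -/
lemma inc_notMem_points (ν : J) (hν : ¬ IsMax ν) {μ : J} (h : μ ≤ ν) (y : K.tower.F.obj μ) :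
    (K.inc μ).toMap y ∉ (Cell.globe ν hν : K.Cell).points := by
  rintro ⟨q, hq, he⟩
  rw [← K.inc_map_apply h, ← K.inc_map_apply (Order.le_succ ν)] at he
  exact K.gHat_notMem_range ν hν hq _ (K.inc_injective _ he)

lemma points_globe_inj {ν μ : J} {hν : ¬ IsMax ν} {hμ : ¬ IsMax μ} {x : K.X}
    (hx : x ∈ (Cell.globe ν hν : K.Cell).points) (hx' : x ∈ (Cell.globe μ hμ : K.Cell).points) :
    ν ≤ μ := by
  by_contra! h
  obtain ⟨q, -, rfl⟩ := hx'
  exact K.inc_notMem_points ν hν (Order.succ_le_of_lt h) _ hx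

lemma state_notMem_points (a : K.X.states) (ν : J) (hν : ¬ IsMax ν) :
    (a : K.X) ∉ (Cell.globe ν hν : K.Cell).points := by
  obtain ⟨s, hs⟩ := K.exists_base_of_mem_states a.2
  rw [← hs, base_eq]
  exact K.inc_notMem_points ν hν bot_le _

/-- Two globular cells with a common point are equal. -/
lemma cell_eq_of_mem_points {x : K.X} {c d : K.Cell} (hc : x ∈ c.points) (hd : x ∈ d.points) :
    c = d := by
  match c, d, hc, hd with
  | .state a, .state b, hc, hd => exact congrArg _ (Subtype.ext (hc.symm.trans hd))
  | .state a, .globe ν hν, hc, hd => exact (K.state_notMem_points a ν hν (hc ▸ hd)).elim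
  | .globe ν hν, .state a, hc, hd => exact (K.state_notMem_points a ν hν (hd ▸ hc)).elim
  | .globe ν hν, .globe μ hμ, hc, hd =>
    obtain rfl := (K.points_globe_inj hc hd).antisymm (K.points_globe_inj hd hc)
    rfl

lemma isCellOf_iff {x : K.X} {c : K.Cell} : K.IsCellOf x c ↔ x ∈ c.points :=
  ⟨fun h => h.1, fun h => ⟨h, fun _ hd => K.cell_eq_of_mem_points hd h⟩⟩

lemma exists_isCellOf (x : K.X) : ∃ c : K.Cell, K.IsCellOf x c :=
  (K.exists_mem_points x).imp fun _ => K.isCellOf_iff.2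

variable {K}

lemma IsCellOf.unique {x : K.X} {c d : K.Cell} (hc : K.IsCellOf x c) (hd : K.IsCellOf x d) :
    c = d := hd.2 c hc.1

lemma isCellOf_state (a : K.X.states) : K.IsCellOf (a : K.X) (.state a) :=
  K.isCellOf_iff.2 rfl

lemma isCellOf_state_iff {x : K.X} {a : K.X.states} : K.IsCellOf x (.state a) ↔ x = a :=
  K.isCellOf_iff

lemma IsCellOf.mem_closedPoints {x : K.X} {c : K.Cell} (h : K.IsCellOf x c) :
    x ∈ c.closedPoints := by
  cases c with
  | state a => exact h.1
  | globe ν hν => exact Set.image_subset_range _ _ h.1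

lemma attach_pt_zero (ν : J) (hν : ¬ IsMax ν) (z : TopCat.disk.{u} (K.n ν hν)) :
    (K.attach ν hν).toMap (Globe.pt z 0) = (Cell.globe ν hν : K.Cell).initial :=
  congrArg _ (Globe.pt_zero z)

lemma attach_pt_one (ν : J) (hν : ¬ IsMax ν) (z : TopCat.disk.{u} (K.n ν hν)) :
    (K.attach ν hν).toMap (Globe.pt z 1) = (Cell.globe ν hν : K.Cell).final :=
  congrArg _ (Globe.pt_one z)

lemma isCellOf_attach_pt (ν : J) (hν : ¬ IsMax ν) {z : TopCat.disk.{u} (K.n ν hν)}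
    (hz : z ∉ Set.range (TopCat.diskBoundaryInclusion.{u} (K.n ν hν)))
    {t : unitInterval} (h0 : t ≠ 0) (h1 : t ≠ 1) :
    K.IsCellOf ((K.attach ν hν).toMap (Globe.pt z t)) (.globe ν hν) :=
  K.isCellOf_iff.2 ⟨_, Globe.pt_notMem_range_mapSpace _ hz h0 h1, rfl⟩

end CellularMultipointedDSpace

/-! ### Traces on a segment -/

namespace CellularMultipointedDSpace

variable {J : Type w} [LinearOrder J] [OrderBot J] [SuccOrder J] [WellFoundedLT J]
  {K : CellularMultipointedDSpace.{w, u} J}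

/-- In a discrete trace, states and cells of positive dimension alternate. -/
lemma Cell.Prec.alternate {c d : K.Cell} (h : c.Prec d) :
    (∃ x ν hν, c = .state x ∧ d = .globe ν hν) ∨ ∃ ν hν y, c = .globe ν hν ∧ d = .state y := by
  obtain ⟨hne, h⟩ := h
  match c, d, hne, h with
  | .state x, .state y, hne, h =>
    exact (hne (h.elim id id)).elim
  | .state x, .globe ν hν, hne, h => exact Or.inl ⟨x, ν, hν, rfl, rfl⟩
  | .globe ν hν, .state y, hne, h => exact Or.inr ⟨ν, hν, y, rfl, rfl⟩
  | .globe ν hν, .globe μ hμ, hne, h => exact (h.elim nofun nofun)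

/-- The map `f` stays in the cell `c` on `[a,b]`, with values in the closed cell at `a` and
`b`. -/
structure Segment (f : unitInterval → K.X) (c : K.Cell) (a b : unitInterval) : Prop where
  le : a ≤ b
  lt : 1 ≤ c.dim → a < b
  closed_mem : ∀ s, a ≤ s → s ≤ b → f s ∈ c.closedPoints
  open_mem : ∀ s, a < s → s < b → K.IsCellOf (f s) c

/-- `Traces f b a L` means that the cells successively visited by `f` on `[a,b]` are those of
the list `L`, except that the first cell is not required to contain `f a`. -/
inductive Traces (f : unitInterval → K.X) (b : unitInterval) :
    unitInterval → List K.Cell → Prop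
  | last {c a} (hc : Segment f c a b) (hb : K.IsCellOf (f b) c) : Traces f b a [c]
  | cons {c d a m L} (hc : Segment f c a m) (hcd : c.Prec d)
      (hm : K.IsCellOf (f m) c ∨ K.IsCellOf (f m) d) (hL : Traces f b m (d :: L)) :
      Traces f b a (c :: d :: L)

variable {f : unitInterval → K.X} {a b e m : unitInterval} {c d : K.Cell} {L L' : List K.Cell}

lemma Segment.mem_state {x : K.X.states} (h : Segment f (.state x) a b) {s : unitInterval}
    (h1 : a ≤ s) (h2 : s ≤ b) : f s = x := h.closed_mem s h1 h2

lemma segment_state {x : K.X.states} (hab : a ≤ b) (h : ∀ s, a ≤ s → s ≤ b → f s = x) :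
    Segment f (.state x) a b where
  le := hab
  lt := fun h => by simp [Cell.dim] at h
  closed_mem := h
  open_mem := fun s h1 h2 => isCellOf_state_iff.2 (h s h1.le h2.le)

lemma Segment.congr {g : unitInterval → K.X} (h : Segment f c a b)
    (hfg : ∀ s, a ≤ s → s ≤ b → f s = g s) : Segment g c a b where
  le := h.le
  lt := h.lt
  closed_mem := fun s h1 h2 => hfg s h1 h2 ▸ h.closed_mem s h1 h2
  open_mem := fun s h1 h2 => hfg s h1.le h2.le ▸ h.open_mem s h1 h2

lemma Segment.trans (h : Segment f c a b) (hb : K.IsCellOf (f b) c) (h' : Segment f c b e) :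
    Segment f c a e where
  le := h.le.trans h'.le
  lt := fun hc => (h.lt hc).trans_le h'.le
  closed_mem := fun s h1 h2 => (le_total s b).elim (h.closed_mem s h1) fun h3 =>
    h'.closed_mem s h3 h2
  open_mem := fun s h1 h2 => by
    obtain h3 | rfl | h3 := lt_trichotomy s b
    · exact h.open_mem s h1 h3
    · exact hb
    · exact h'.open_mem s h3 h2

lemma Traces.le (h : Traces f b a L) : a ≤ b := by
  induction h with
  | last hc hb => exact hc.le
  | cons hc hcd hm hL ih => exact hc.le.trans ih

lemma Traces.segment (h : Traces f b a (c :: L)) : ∃ m ≤ b, Segment f c a m := by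
  cases h with
  | last hc hb => exact ⟨b, le_rfl, hc⟩
  | cons hc hcd hm hL => exact ⟨_, hL.le, hc⟩

lemma Traces.congr {g : unitInterval → K.X} (h : Traces f b a L)
    (hfg : ∀ s, a ≤ s → s ≤ b → f s = g s) : Traces g b a L := by
  induction h with
  | last hc hb => exact .last (hc.congr hfg) (hfg b hc.le le_rfl ▸ hb)
  | cons hc hcd hm hL ih =>
    exact .cons (hc.congr fun s h1 h2 => hfg s h1 (h2.trans hL.le)) hcd
      (hfg _ hc.le hL.le ▸ hm) (ih fun s h1 h2 => hfg s (hc.le.trans h1) h2)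

lemma Traces.extend (hc : Segment f c a b) (hb : K.IsCellOf (f b) c)
    (h : Traces f e b (c :: L)) : Traces f e a (c :: L) := by
  cases h with
  | last hc' he => exact .last (hc.trans hb hc') he
  | cons hc' hcd hm hL => exact .cons (hc.trans hb hc') hcd hm hL

lemma Traces.append (h : Traces f b a L) (hb : K.IsCellOf (f b) d)
    (h' : Traces f e b (d :: L')) : ∃ L'', Traces f e a L'' ∧ L''.head? = L.head? := by
  induction h with
  | last hc hb' =>
    obtain rfl := hb.unique hb'
    exact ⟨_, h'.extend hc hb, rfl⟩
  | cons hc hcd hm hL ih =>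
    obtain ⟨L'', h1, h2⟩ := ih
    obtain ⟨L₀, rfl⟩ : ∃ L₀, L'' = _ :: L₀ := List.head?_eq_some_iff.1 h2
    exact ⟨_, .cons hc hcd hm h1, rfl⟩

/-- The map `f` has a trace on `[a,b]`, starting with the cell of `f a`. -/
def HasTrace (f : unitInterval → K.X) (a b : unitInterval) : Prop :=
  ∃ (c : K.Cell) (L : List K.Cell), K.IsCellOf (f a) c ∧ Traces f b a (c :: L)

lemma HasTrace.congr {g : unitInterval → K.X} (h : HasTrace f a b)
    (hfg : ∀ s, a ≤ s → s ≤ b → f s = g s) : HasTrace g a b := by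
  obtain ⟨c, L, hc, hL⟩ := h
  exact ⟨c, L, hfg a le_rfl hL.le ▸ hc, hL.congr hfg⟩

lemma HasTrace.trans (h : HasTrace f a b) (h' : HasTrace f b e) : HasTrace f a e := by
  obtain ⟨c, L, hc, hL⟩ := h
  obtain ⟨d, L', hd, hL'⟩ := h'
  obtain ⟨L'', h1, h2⟩ := hL.append hd hL'
  obtain ⟨L₀, rfl⟩ := List.head?_eq_some_iff.1 h2
  exact ⟨c, L₀, hc, h1⟩

lemma hasTrace_of_isCellOf (hab : a < b) (h : ∀ s, a ≤ s → s ≤ b → K.IsCellOf (f s) c) :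
    HasTrace f a b :=
  ⟨c, [], h a le_rfl hab.le, .last
    { le := hab.le
      lt := fun _ => hab
      closed_mem := fun s h1 h2 => (h s h1 h2).mem_closedPoints
      open_mem := fun s h1 h2 => h s h1.le h2.le } (h b hab.le le_rfl)⟩

/-! ### Uniqueness of the trace -/

/-- If the trace of `f` on `[m,b]` starts with a cell `d` that follows `c`, then `f` does not stay
in `c` after `m`: it is in `d` at `m` if `d` is a state, and immediately after `m` otherwise. -/
lemma Traces.le_of_prec (h : Traces f b m (d :: L)) (hcd : c.Prec d) {m' : unitInterval}
    (hc : Segment f c a m) (hc' : Segment f c a m') : m' ≤ m := by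
  by_contra! hlt
  obtain ⟨x, ν, hν, rfl, rfl⟩ | ⟨ν, hν, y, rfl, rfl⟩ := hcd.alternate
  · obtain ⟨m₂, -, hd⟩ := h.segment
    obtain ⟨s, h1, h2⟩ := exists_between (lt_min (hd.lt (by simp [Cell.dim])) hlt)
    have h3 := hd.open_mem s h1 (h2.trans_le (min_le_left _ _))
    rw [hc'.mem_state (hc.le.trans h1.le) (h2.le.trans (min_le_right _ _))] at h3
    exact hcd.1 ((isCellOf_state x).unique h3)
  · obtain ⟨m₂, -, hd⟩ := h.segment
    have h3 := hc'.open_mem m (hc.lt (by simp [Cell.dim])) hlt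
    rw [hd.mem_state le_rfl hd.le] at h3
    exact hcd.1 (h3.unique (isCellOf_state y))

lemma Traces.next_unique {d' : K.Cell} (h : Traces f b m (d :: L)) (h' : Traces f b m (d' :: L'))
    (hcd : c.Prec d) (hcd' : c.Prec d') : d = d' := by
  obtain ⟨m₂, -, hd⟩ := h.segment
  obtain ⟨m₃, -, hd'⟩ := h'.segment
  obtain ⟨x, ν, hν, rfl, rfl⟩ | ⟨ν, hν, y, rfl, rfl⟩ := hcd.alternate <;>
  obtain ⟨x', ν', hν', hx, rfl⟩ | ⟨ν', hν', y', hx, rfl⟩ := hcd'.alternate <;> cases hx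
  · obtain ⟨s, h1, h2⟩ := exists_between (lt_min (hd.lt (by simp [Cell.dim]))
      (hd'.lt (by simp [Cell.dim])))
    exact (hd.open_mem s h1 (h2.trans_le (min_le_left _ _))).unique
      (hd'.open_mem s h1 (h2.trans_le (min_le_right _ _)))
  · exact congrArg _ (Subtype.ext ((hd.mem_state le_rfl hd.le).symm.trans
      (hd'.mem_state le_rfl hd'.le)))

/-- A cell with which a trace ends is not followed by another one. -/
lemma Segment.not_cons (hc : Segment f c a b) (hb : K.IsCellOf (f b) c) (hm : Segment f c a m)
    (hcd : c.Prec d) (h : Traces f b m (d :: L)) : False := by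
  obtain rfl : m = b := h.le.antisymm (h.le_of_prec hcd hm hc)
  obtain ⟨m₂, h2, hd⟩ := h.segment
  obtain ⟨x, ν, hν, rfl, rfl⟩ | ⟨ν, hν, y, rfl, rfl⟩ := hcd.alternate
  · exact (hd.lt (by simp [Cell.dim])).not_ge h2
  · rw [hd.mem_state le_rfl hd.le] at hb
    exact hcd.1 (hb.unique (isCellOf_state y))

/-- A trace is determined by its first cell. -/
lemma Traces.unique (h : Traces f b a L) (h' : Traces f b a L') (hh : L.head? = L'.head?) :
    L = L' := by
  induction h generalizing L' with
  | last hc hb =>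
    cases h' with
    | last hc' hb' => simpa using hh
    | cons hc' hcd' hm' hL' =>
      obtain rfl := Option.some.inj hh
      exact (hc.not_cons hb hc' hcd' hL').elim
  | cons hc hcd hm hL ih =>
    cases h' with
    | last hc' hb' =>
      obtain rfl := Option.some.inj hh
      exact (hc'.not_cons hb' hc hcd hL).elim
    | cons hc' hcd' hm' hL' =>
      obtain rfl := Option.some.inj hh
      obtain rfl := (hL'.le_of_prec hcd' hc' hc).antisymm
        (hL.le_of_prec hcd hc hc')
      obtain rfl := hL.next_unique hL' hcd hcd'
      rw [ih hL' rfl]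

/-! ### Existence of the trace -/

/-- A monotone path in a globe, which is run through along `(z,t)` with `z` not on the boundary
of the disk and leaves the initial vertex immediately, begins with the cell of that globe. -/
lemma traces_attach_pt (ν : J) (hν : ¬ IsMax ν) {z : TopCat.disk.{u} (K.n ν hν)}
    (hz : z ∉ Set.range (TopCat.diskBoundaryInclusion.{u} (K.n ν hν)))
    {ψ : unitInterval → unitInterval} (hψ : Monotone ψ) (hψc : Continuous ψ) (hab : a < b)
    (h0 : ∀ s, a < s → s ≤ b → ψ s ≠ 0) (h1 : ψ a ≠ 1) :
    ∃ L, Traces (fun s => (K.attach ν hν).toMap (Globe.pt z (ψ s))) b a (.globe ν hν :: L) := by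
  by_cases hb : ψ b = 1
  · have hcomp : IsCompact {s | s ∈ Set.Icc a b ∧ ψ s = 1} :=
      (isClosed_Icc.inter (isClosed_singleton.preimage hψc)).isCompact
    obtain ⟨m, ⟨hm, hm1⟩, hmin⟩ := hcomp.exists_isLeast ⟨b, ⟨hab.le, le_rfl⟩, hb⟩
    have ham : a < m := hm.1.lt_of_ne (by rintro rfl; exact h1 hm1)
    have hfin : ∀ s, m ≤ s → (K.attach ν hν).toMap (Globe.pt z (ψ s)) =
        (Cell.globe ν hν : K.Cell).final := fun s hs => by
      have : ψ s = 1 := le_antisymm unitInterval.le_one' (hm1.ge.trans (hψ hs))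
      rw [this, attach_pt_one]
    refine ⟨[.state (Cell.globe ν hν : K.Cell).final], .cons (m := m) ?_ ⟨nofun, Or.inr rfl⟩
      (Or.inr (isCellOf_state_iff.2 (hfin m le_rfl)))
      (.last (segment_state hm.2 fun s hs _ => hfin s hs) (isCellOf_state_iff.2 (hfin b hm.2)))⟩
    exact
      { le := ham.le
        lt := fun _ => ham
        closed_mem := fun s _ _ => ⟨_, rfl⟩
        open_mem := fun s hs hs' => isCellOf_attach_pt ν hν hz (h0 s hs (hs'.le.trans hm.2))
          fun h => hs'.not_ge (hmin ⟨⟨hs.le, hs'.le.trans hm.2⟩, h⟩) }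
  · have hlt : ∀ s, s ≤ b → ψ s ≠ 1 := fun s hs h =>
      hb (le_antisymm unitInterval.le_one' (h.ge.trans (hψ hs)))
    exact ⟨[], .last
      { le := hab.le
        lt := fun _ => hab
        closed_mem := fun s _ _ => ⟨_, rfl⟩
        open_mem := fun s hs hs' => isCellOf_attach_pt ν hν hz (h0 s hs hs'.le) (hlt s hs'.le) }
      (isCellOf_attach_pt ν hν hz (h0 b hab le_rfl) (hlt b le_rfl))⟩

lemma hasTrace_attach_pt (ν : J) (hν : ¬ IsMax ν) {z : TopCat.disk.{u} (K.n ν hν)}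
    (hz : z ∉ Set.range (TopCat.diskBoundaryInclusion.{u} (K.n ν hν)))
    {ψ : unitInterval → unitInterval} (hψ : Monotone ψ) (hψc : Continuous ψ) (hab : a < b) :
    HasTrace (fun s => (K.attach ν hν).toMap (Globe.pt z (ψ s))) a b := by
  by_cases h0 : ψ a = 0
  · have hcomp : IsCompact {s | s ∈ Set.Icc a b ∧ ψ s = 0} :=
      (isClosed_Icc.inter (isClosed_singleton.preimage hψc)).isCompact
    obtain ⟨m, ⟨hm, hm0⟩, hmax⟩ := hcomp.exists_isGreatest ⟨a, ⟨le_rfl, hab.le⟩, h0⟩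
    have hini : ∀ s, s ≤ m → (K.attach ν hν).toMap (Globe.pt z (ψ s)) =
        (Cell.globe ν hν : K.Cell).initial := fun s hs => by
      have : ψ s = 0 := le_antisymm ((hψ hs).trans hm0.le) unitInterval.nonneg'
      rw [this, attach_pt_zero]
    obtain rfl | hmb := hm.2.eq_or_lt
    · exact hasTrace_of_isCellOf hab fun s _ hs => isCellOf_state_iff.2 (hini s hs)
    · obtain ⟨L, hL⟩ := traces_attach_pt ν hν hz hψ hψc hmb
        (fun s hs hs' h => hs.not_ge (hmax ⟨⟨hm.1.trans hs.le, hs'⟩, h⟩)) (by simp [hm0])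
      exact ⟨.state (Cell.globe ν hν : K.Cell).initial, _, isCellOf_state_iff.2 (hini a hm.1),
        .cons (d := .globe ν hν) (segment_state hm.1 fun s _ hs => hini s hs)
          ⟨nofun, Or.inl rfl⟩
          (Or.inl (isCellOf_state_iff.2 (hini m le_rfl))) hL⟩
  by_cases h1 : ψ a = 1
  · refine hasTrace_of_isCellOf (c := .state (Cell.globe ν hν : K.Cell).final) hab
      fun s hs _ => isCellOf_state_iff.2 ?_
    have : ψ s = 1 := le_antisymm unitInterval.le_one' (h1.ge.trans (hψ hs))
    rw [this, attach_pt_one]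
  · obtain ⟨L, hL⟩ := traces_attach_pt ν hν hz hψ hψc hab
      (fun s hs _ h => h0 (le_antisymm ((hψ hs.le).trans h.le) unitInterval.nonneg')) h1
    exact ⟨_, L, isCellOf_attach_pt ν hν hz h0 h1, hL⟩

/-- The path `σ`, run through along any monotone reparametrization, has a trace on every
non-degenerate segment. -/
def MonotoneTraceable (σ : unitInterval → K.X) : Prop :=
  ∀ ψ : unitInterval → unitInterval, Monotone ψ → Continuous ψ → ∀ a b, a < b →
    HasTrace (fun s => σ (ψ s)) a b

lemma MonotoneTraceable.normComp {σ₁ σ₂ : C(unitInterval, K.X)} (h₁ : MonotoneTraceable σ₁)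
    (h₂ : MonotoneTraceable σ₂) (h : σ₁ 1 = σ₂ 0) : MonotoneTraceable (normComp σ₁ σ₂ h) := by
  intro ψ hψ hψc a b hab
  have hmono : ∀ r : ℝ, Monotone fun s => Set.projIcc (0 : ℝ) 1 zero_le_one (2 * (ψ s : ℝ) - r) :=
    fun r s t hst => Set.monotone_projIcc _ (by have : (ψ s : ℝ) ≤ ψ t := hψ hst; linarith)
  have hcont : ∀ r : ℝ,
      Continuous fun s => Set.projIcc (0 : ℝ) 1 zero_le_one (2 * (ψ s : ℝ) - r) :=
    fun r => continuous_projIcc.comp (by fun_prop)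
  have left : ∀ a b, a < b → (ψ b : ℝ) ≤ 1 / 2 →
      HasTrace (fun s => _root_.normComp σ₁ σ₂ h (ψ s)) a b := fun a b hab hb => by
    refine (h₁ _ (hmono 0) (hcont 0) a b hab).congr fun s _ hs => ?_
    have hs' : (ψ s : ℝ) ≤ ψ b := hψ hs
    rw [normComp_apply, if_pos (hs'.trans hb), sub_zero]
  have right : ∀ a b, a < b → 1 / 2 ≤ (ψ a : ℝ) →
      HasTrace (fun s => _root_.normComp σ₁ σ₂ h (ψ s)) a b := fun a b hab ha => by
    refine (h₂ _ (hmono 1) (hcont 1) a b hab).congr fun s hs _ => ?_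
    have hs' : (ψ a : ℝ) ≤ ψ s := hψ hs
    rw [normComp_apply]
    split_ifs with hle
    -- at the parameter `1/2` both formulas give the common endpoint
    · have he : (ψ s : ℝ) = 1 / 2 := by linarith
      rw [he, Set.projIcc_of_le_left _ (by norm_num), Set.projIcc_of_right_le _ (by norm_num)]
      exact h.symm
    · rfl
  rcases le_or_gt (ψ b : ℝ) (1 / 2) with hb | hb
  · exact left a b hab hb
  rcases le_or_gt (1 / 2) (ψ a : ℝ) with ha | ha
  · exact right a b hab ha
  obtain ⟨m, hm, hm'⟩ := intermediate_value_Icc (f := fun s => (ψ s : ℝ)) hab.le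
    (by fun_prop) ⟨ha.le, hb.le⟩
  simp only at hm'
  refine (left a m (hm.1.lt_of_ne ?_) hm'.le).trans (right m b (hm.2.lt_of_ne ?_) hm'.ge)
  · rintro rfl; exact ha.ne hm'
  · rintro rfl; exact hb.ne' hm'

lemma monotoneTraceable_of_mem_paths {σ : C(unitInterval, K.X)} (hσ : σ ∈ K.X.paths) :
    MonotoneTraceable σ := by
  let P : PathClass K.X :=
    { points := Set.univ
      paths := {σ | MonotoneTraceable σ}
      comp_mem := fun σ h φ hφ ψ hψ hψc => h (fun s => φ (ψ s)) (hφ.1.comp hψ)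
        (φ.continuous.comp hψc)
      normComp_mem := fun σ₁ h₁ σ₂ h₂ h => h₁.normComp h₂ h }
  exact (K.contains_id P (fun _ => Set.mem_univ _) fun ν hν z hz ψ hψ hψc a b hab =>
    hasTrace_attach_pt ν hν hz hψ hψc hab).2 σ hσ

lemma hasTrace_of_mem_directedPaths {γ : C(unitInterval, K.X)} (hγ : γ ∈ K.X.directedPaths) :
    HasTrace γ 0 1 := by
  obtain ⟨x, rfl⟩ | ⟨n, ℓ, σ, φ, hℓ, hsum, hσ, hφ, hγ⟩ := hγ
  · obtain ⟨c, hc⟩ := K.exists_isCellOf x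
    exact hasTrace_of_isCellOf zero_lt_one fun _ _ _ => hc
  -- `T k` is the end of the `k`-th segment
  let T : ℕ → ℝ := fun k => ∑ j ∈ Finset.univ.filter (fun j : Fin n => (j : ℕ) < k), ℓ j
  have hT0 : T 0 = 0 := by simp [T]
  have hTn : T n = 1 := by simp [T, hsum]
  have hIio : ∀ i : Fin n, ∑ j ∈ Finset.Iio i, ℓ j = T i := fun i => by
    refine Finset.sum_congr ?_ fun _ _ => rfl
    ext j; simp
  have hIic : ∀ i : Fin n, ∑ j ∈ Finset.Iic i, ℓ j = T (i + 1) := fun i => by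
    refine Finset.sum_congr ?_ fun _ _ => rfl
    ext j; simp
  have hstep : ∀ i : Fin n, T (i + 1) = T i + ℓ i := fun i => by
    rw [← hIic, ← hIio, ← Finset.Iio_insert, Finset.sum_insert (by simp), add_comm]
  have hTmem : ∀ k, T k ∈ Set.Icc (0 : ℝ) 1 := fun k =>
    ⟨Finset.sum_nonneg fun j _ => (hℓ j).le,
      hsum ▸ Finset.sum_le_sum_of_subset_of_nonneg (Finset.subset_univ _) fun j _ _ => (hℓ j).le⟩
  have hpiece : ∀ i : Fin n, HasTrace γ ⟨T i, hTmem i⟩ ⟨T (i + 1), hTmem (i + 1)⟩ := fun i => by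
    refine (monotoneTraceable_of_mem_paths (hσ i)
      (fun s => φ i (Set.projIcc (0 : ℝ) 1 zero_le_one (((s : ℝ) - T i) / ℓ i))) ?_ ?_ _ _
      (Subtype.mk_lt_mk.2 (by linarith [hstep i, hℓ i]))).congr fun s hs hs' => ?_
    · intro s t hst
      refine hφ i (Set.monotone_projIcc _ ?_)
      have : (s : ℝ) ≤ t := hst
      have := (hℓ i).le
      gcongr
    · exact (φ i).continuous.comp (continuous_projIcc.comp (by fun_prop))
    · rw [hγ i s ((hIio i).trans_le (Subtype.coe_le_coe.2 hs))
        ((Subtype.coe_le_coe.2 hs').trans_eq (hIic i).symm), hIio]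
  have hall : ∀ k, k < n → HasTrace γ ⟨T 0, hTmem 0⟩ ⟨T (k + 1), hTmem (k + 1)⟩ := by
    intro k
    induction k with
    | zero => exact fun hk => hpiece ⟨0, hk⟩
    | succ k ih => exact fun hk => (ih (by omega)).trans (hpiece ⟨k + 1, hk⟩)
  obtain _ | n := n
  · simp [hTn] at hT0
  · have h := hall n (by omega)
    have e0 : (⟨T 0, hTmem 0⟩ : unitInterval) = 0 := Subtype.ext hT0
    have e1 : (⟨T (n + 1), hTmem (n + 1)⟩ : unitInterval) = 1 := Subtype.ext hTn
    rwa [e0, e1] at h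

end CellularMultipointedDSpace

/-! ### Traces and subdivisions -/

namespace CellularMultipointedDSpace

variable {J : Type w} [LinearOrder J] [OrderBot J] [SuccOrder J] [WellFoundedLT J]
  {K : CellularMultipointedDSpace.{w, u} J} {f : unitInterval → K.X} {a b : unitInterval}
  {L : List K.Cell}

lemma Traces.exists_subdivision (h : Traces f b a L) :
    K.IsDiscreteTrace L ∧ ∃ t : Fin (L.length + 1) → unitInterval, t 0 = a ∧
      t (Fin.last _) = b ∧ (∀ i : Fin L.length, Segment f (L.get i) (t i.castSucc) (t i.succ)) ∧
      (∀ (i : ℕ) (h : i + 1 < L.length), K.IsCellOf (f (t ⟨i + 1, by omega⟩)) L[i] ∨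
        K.IsCellOf (f (t ⟨i + 1, by omega⟩)) L[i + 1]) ∧
      ∀ c ∈ L.getLast?, K.IsCellOf (f b) c := by
  induction h with
  | @last c a hc hb =>
    refine ⟨⟨by simp, by simp⟩, ![a, b], rfl, rfl, fun i => ?_, fun i hi => ?_, by simpa using hb⟩
    · fin_cases i; exact hc
    · simp at hi
  | @cons c d a m L hc hcd hm hL ih =>
    obtain ⟨⟨-, hchain⟩, t, rfl, hlast, hseg, hbr, hend⟩ := ih
    refine ⟨⟨by simp, List.isChain_cons_cons.2 ⟨hcd, hchain⟩⟩, Fin.cons a t, rfl, ?_,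
      fun i => ?_, fun i hi => ?_, ?_⟩
    · exact hlast
    · induction i using Fin.cases with
      | zero => exact hc
      | succ i => exact hseg i
    · cases i with
      | zero => exact hm
      | succ i => exact hbr i (by simpa using hi)
    · simpa using hend

lemma traces_of_subdivision (hL : K.IsDiscreteTrace L) (t : Fin (L.length + 1) → unitInterval)
    (h0 : t 0 = a) (h1 : t (Fin.last _) = b)
    (hseg : ∀ i : Fin L.length, Segment f (L.get i) (t i.castSucc) (t i.succ))
    (hbr : ∀ (i : ℕ) (h : i + 1 < L.length), K.IsCellOf (f (t ⟨i + 1, by omega⟩)) L[i] ∨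
      K.IsCellOf (f (t ⟨i + 1, by omega⟩)) L[i + 1])
    (hend : ∀ c ∈ L.getLast?, K.IsCellOf (f b) c) : Traces f b a L := by
  induction L generalizing a with
  | nil => exact (hL.1 rfl).elim
  | cons c L ih =>
    subst h0 h1
    cases L with
    | nil => exact .last (hseg 0) (hend c rfl)
    | cons d L =>
      obtain ⟨hcd, hchain⟩ := List.isChain_cons_cons.1 hL.2
      exact .cons (hseg 0) hcd (hbr 0 (by simp)) (ih ⟨by simp, hchain⟩ (Fin.tail t) rfl rfl
        (fun i => hseg i.succ) (fun i hi => hbr (i + 1) (by simpa using hi))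
        (by simpa using hend))

lemma subdivides_iff_traces {γ : C(unitInterval, K.X)} {L : List K.Cell} :
    (K.IsDiscreteTrace L ∧ ∃ t : Fin (L.length + 1) → unitInterval, K.Subdivides γ L t) ↔
      Traces γ 1 0 L ∧ ∀ c ∈ L.head?, K.IsCellOf (γ 0) c := by
  constructor
  · rintro ⟨hL, t, ht⟩
    exact ⟨traces_of_subdivision hL t ht.first ht.last
      (fun i => ⟨ht.mono i.castSucc_lt_succ.le, ht.nondegenerate i, ht.closed_mem i,
        ht.open_mem i⟩) ht.break_mem ht.target_mem, ht.source_mem⟩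
  · rintro ⟨h, hs⟩
    obtain ⟨hL, t, h0, h1, hseg, hbr, hend⟩ := h.exists_subdivision
    exact ⟨hL, t,
      { first := h0
        last := h1
        mono := Fin.monotone_iff_le_succ.2 fun i => (hseg i).le
        nondegenerate := fun i => (hseg i).lt
        ne_next := fun i hi => (List.isChain_iff_getElem.1 hL.2 i hi).1
        closed_mem := fun i => (hseg i).closed_mem
        open_mem := fun i => (hseg i).open_mem
        break_mem := hbr
        source_mem := hs
        target_mem := hend }⟩

end CellularMultipointedDSpace

end

theorem theorem4p6 {J : Type w} [LinearOrder J] [OrderBot J] [SuccOrder J] [WellFoundedLT J]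
    (K : CellularMultipointedDSpace.{w, u} J) (γ : C(unitInterval, K.X))
    (hγ : γ ∈ K.X.directedPaths) :
    ∃! L : List K.Cell, K.IsDiscreteTrace L ∧
      ∃ t : Fin (L.length + 1) → unitInterval, K.Subdivides γ L t := by
  simp only [CellularMultipointedDSpace.subdivides_iff_traces]
  obtain ⟨c, L, hc, hL⟩ := CellularMultipointedDSpace.hasTrace_of_mem_directedPaths hγ
  refine ⟨c :: L, ⟨hL, by simpa using hc⟩, fun L' ⟨hL', hc'⟩ => hL'.unique hL ?_⟩
  cases hL' with
  | last | cons => exact congrArg some ((hc' _ rfl).unique hc)
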